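/- Let $d\ge 1$ and let $\mathscr P_2(\mathbb R^d)$ be the set of Borel probability measures on $\mathbb R^d$ with finite second moment, with the Wasserstein metric $W_2$. For $\mu,\nu\in\mathscr P_2(\mathbb R^d)$ let $\Pi(\mu,\nu)$ be the set of measures $\gamma$ on $\mathbb R^d\times\mathbb R^d$ with marginals $\mu$ and $\nu$. A function $U$ on $\mathscr P_2(\mathbb R^d)$ has the Wasserstein derivative $\partial_\mu U(\mu,\cdot)\in L^2(\mu)$ at $\mu$ if $$U(\nu)-U(\mu)-\int\partial_\mu U(\mu,x)(y-x)\,d\gamma(x,y)=o\Big(\big(\textstyle\int|x-y|^2d\gamma\big)^{1/2}\Big)$$ uniformly over $\nu\in\mathscr P_2(\mathbb R^d)$ and $\gamma\in\Pi(\mu,\nu)$. A function of vector variables and $\mu$ is fully $C^1$ if it and its derivatives in the vector variables and in $\mu$ (the latter with a version defined at every $\tilde x\in\mathbb R^d$) exist and are jointly continuous in all variables (including $\tilde x$). A function $H:\mathbb R^d\times\mathscr P_2(\mathbb R^d)\times\mathbb R^d\to\mathbb R$, $(x,\mu,p)\mapsto H(x,\mu,p)$, is fully $C^2$ if $H$,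 $\partial_xH$, $\partial_pH$ and $\partial_\mu H(x,\mu,\tilde x,p)$ are fully $C^1$. Such an $H$, with $H(\cdot,\mu,\cdot)\in C^1$ for every $\mu$, is called displacement monotone if $$\int_{\mathbb R^d\times\mathbb R^d}\Big(-[\partial_xH(x,\mu,p^1(x))-\partial_xH(y,\nu,p^2(y))]\cdot(x-y)+[\partial_pH(x,\mu,p^1(x))-\partial_pH(y,\nu,p^2(y))]\cdot(p^1(x)-p^2(y))\Big)d\gamma(x,y)\ \ge\ 0$$ for all $\mu,\nu\in\mathscr P_2(\mathbb R^d)$, $\gamma\in\Pi(\mu,\nu)$ and all bounded continuous $p^1,p^2:\mathbb R^d\to\mathbb R^d$; this includes that the integral exists in $(-\infty,+\infty]$. Let $|\partial_{xx}H|,|\partial_{pp}H|$ be the suprema over $(x,\mu,p)$, and $|\partial_{x\mu}H|,|\partial_{p\mu}H|$ the suprema over $(x,\mu,\tilde x,p)$, of the matrix $2$-norms of $\partial_{xx}H$, $\partial_{pp}H$, $\partial_{x\mu}H$, $\partial_{p\mu}H$, and let $$\underline\kappa(\partial_{xp}H):=\inf_{(x,\mu,p)}\lambda_{\min}\Big(\tfrac12\big(\partial_{xp}H+(\partial_{xp}H)^\top\big)(x,\mu,p)\Big),$$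 where $\lambda_{\min}$ is the smallest eigenvalue. **Theorem.** Let $H$ be fully $C^2$, and let $c_0>0$ be such that $\partial_{pp}H(x,\mu,p)\ge c_0^{-1}I$ for all $(x,\mu,p)$. Suppose that $\underline\kappa(\partial_{xp}H)$, $|\partial_{pp}H|$, $|\partial_{xx}H|$, $|\partial_{p\mu}H|$ and $|\partial_{x\mu}H|$ are finite. Put $$L^H_{our}:=|\partial_{x\mu}H|+\tfrac14c_0|\partial_{p\mu}H|^2+|\partial_{xx}H|$$ and suppose that $\underline\kappa(\partial_{xp}H)\ge\tfrac12|\partial_{p\mu}H|+\sqrt{|\partial_{pp}H|\,L^H_{our}}$. Then the Hamiltonian $H_\alpha(x,\mu,p):=H(x,\mu,p-\alpha x)$ is displacement monotone for every $\alpha\in[\alpha^H_-,\alpha^H_+]$, where $$\alpha^H_\pm:=\frac{\underline\kappa(\partial_{xp}H)-\frac12|\partial_{p\mu}H|\pm\sqrt{\big(\underline\kappa(\partial_{xp}H)-\frac12|\partial_{p\mu}H|\big)^2-|\partial_{pp}H|\,L^H_{our}}}{|\partial_{pp}H|}.$$ In particular, this holds for $\alpha=\big(\underline\kappa(\partial_{xp}H)-\frac12|\partial_{p\mu}H|\big)/|\partial_{pp}H|$.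 -/

import Mathlib

open MeasureTheory Set Topology
open scoped ENNReal BoundedContinuousFunction RealInnerProductSpace

noncomputable section

namespace MFG

/-- The Euclidean space `ℝᵈ`. -/
abbrev E (d : ℕ) : Type := EuclideanSpace ℝ (Fin d)

/-- The set of Borel probability measures on `ℝᵈ` with finite second moment. It is a structure of
its own, so that it carries the topology of the Wasserstein distance and not the weak one. -/
structure P2 (d : ℕ) where
  toMeasure : Measure (E d)
  isProbabilityMeasure : IsProbabilityMeasure toMeasure
  secondMoment : Integrable (fun x => ‖x‖ ^ 2) toMeasure

/-- `γ` is a transport plan of `μ` onto `ν`. Such a `γ` is automatically a probability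
measure with finite second moment. -/
structure IsPlan {d : ℕ} (γ : Measure (E d × E d)) (μ ν : P2 d) : Prop where
  map_fst : γ.map Prod.fst = μ.toMeasure
  map_snd : γ.map Prod.snd = ν.toMeasure

/-- The quadratic cost `∫ |x - y|² dγ(x, y)`; it is finite for every transport plan between
members of `P2 d`. -/
def quadCost {d : ℕ} (γ : Measure (E d × E d)) : ℝ :=
  ∫ z, ‖z.1 - z.2‖ ^ 2 ∂γ

/-- The Wasserstein distance `W₂`. -/
def W2 {d : ℕ} (μ ν : P2 d) : ℝ :=
  Real.sqrt (⨅ γ : {γ : Measure (E d × E d) // IsPlan γ μ ν}, quadCost γ.1)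

/-- The topology of the Wasserstein space: a set is open if it contains a `W₂`-ball around each
of its points. -/
instance {d : ℕ} : TopologicalSpace (P2 d) where
  IsOpen U := ∀ μ ∈ U, ∃ ε > 0, ∀ ν, W2 μ ν < ε → ν ∈ U
  isOpen_univ := fun _ _ => ⟨1, one_pos, fun _ _ => mem_univ _⟩
  isOpen_inter := by
    rintro U V hU hV μ ⟨hμU, hμV⟩
    obtain ⟨ε₁, h₁, H₁⟩ := hU μ hμU
    obtain ⟨ε₂, h₂, H₂⟩ := hV μ hμV
    exact ⟨min ε₁ ε₂, lt_min h₁ h₂, fun ν hν =>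
      ⟨H₁ ν (hν.trans_le (min_le_left _ _)), H₂ ν (hν.trans_le (min_le_right _ _))⟩⟩
  isOpen_sUnion := by
    rintro S hS μ ⟨U, hU, hμ⟩
    obtain ⟨ε, hε, H⟩ := hS U hU μ hμ
    exact ⟨ε, hε, fun ν hν => ⟨U, hU, H ν hν⟩⟩

section WassersteinDerivative

variable {d : ℕ} {W : Type*} [NormedAddCommGroup W] [NormedSpace ℝ W]

/-- `D` is the Wasserstein (Lions) derivative of `U` at `μ`:
`U (law (ξ + η)) = U μ + 𝔼[D(ξ) η] + o(‖η‖_{L²})` for random variables `ξ` with law `μ`.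
The pair `(ξ, ξ + η)` enters only through its joint law, a transport plan `γ`. For `W = ℝ`, the
linear form `D x` is the scalar product with the Wasserstein gradient at the point `x`. -/
def HasWDerivAt (U : P2 d → W) (D : E d → E d →L[ℝ] W) (μ : P2 d) : Prop :=
  MemLp D 2 μ.toMeasure ∧
    ∀ ε > 0, ∃ δ > 0, ∀ (ν : P2 d) (γ : Measure (E d × E d)), IsPlan γ μ ν →
      Real.sqrt (quadCost γ) < δ →
        ‖U ν - U μ - ∫ z, D z.1 (z.2 - z.1) ∂γ‖ ≤ ε * Real.sqrt (quadCost γ)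

/-- `D` is a version of the Wasserstein derivative of `U` that is continuous on
`P2 d × ℝᵈ`. Such a version is unique, because the measures of full support are dense. -/
def IsWDeriv (U : P2 d → W) (D : P2 d → E d → E d →L[ℝ] W) : Prop :=
  Continuous (fun z : P2 d × E d => D z.1 z.2) ∧ ∀ μ, HasWDerivAt U (D μ) μ

open Classical in
/-- The continuous Wasserstein derivative `∂_μ U (μ, x̃)` (zero if there is none). -/
def wDeriv (U : P2 d → W) : P2 d → E d → E d →L[ℝ] W :=
  if h : ∃ D, IsWDeriv U D then h.choose else 0

/-- Fully `C¹` functions of a vector `z` and a measure `μ`: the function, its derivative in `z`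
and its Wasserstein derivative in `μ` exist and are continuous in all the variables jointly. -/
structure FullyC1 {X : Type*} [NormedAddCommGroup X] [NormedSpace ℝ X]
    (F : X → P2 d → W) : Prop where
  continuous : Continuous (fun z : X × P2 d => F z.1 z.2)
  differentiable : ∀ μ, Differentiable ℝ (fun x => F x μ)
  continuous_fderiv : Continuous (fun z : X × P2 d => fderiv ℝ (fun x => F x z.2) z.1)
  exists_wDeriv : ∀ x, ∃ D, IsWDeriv (F x) D
  continuous_wDeriv : Continuous (fun z : X × P2 d × E d => wDeriv (F z.1) z.2.1 z.2.2)

end WassersteinDerivative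

section Hamiltonian

variable {d : ℕ}

/-- `∂_x H (x, μ, p)`. -/
def dx (H : E d → P2 d → E d → ℝ) (x : E d) (μ : P2 d) (p : E d) : E d :=
  gradient (fun y => H y μ p) x

/-- `∂_p H (x, μ, p)`. -/
def dp (H : E d → P2 d → E d → ℝ) (x : E d) (μ : P2 d) (p : E d) : E d :=
  gradient (fun q => H x μ q) p

/-- `∂_{xx} H (x, μ, p)`. -/
def dxx (H : E d → P2 d → E d → ℝ) (x : E d) (μ : P2 d) (p : E d) : E d →L[ℝ] E d :=
  fderiv ℝ (fun y => dx H y μ p) x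

/-- `∂_{xp} H (x, μ, p)`. -/
def dxp (H : E d → P2 d → E d → ℝ) (x : E d) (μ : P2 d) (p : E d) : E d →L[ℝ] E d :=
  fderiv ℝ (fun q => dx H x μ q) p

/-- `∂_{pp} H (x, μ, p)`. -/
def dpp (H : E d → P2 d → E d → ℝ) (x : E d) (μ : P2 d) (p : E d) : E d →L[ℝ] E d :=
  fderiv ℝ (fun q => dp H x μ q) p

/-- `∂_{xμ} H (x, μ, x̃, p)`. -/
def dxμ (H : E d → P2 d → E d → ℝ) (x : E d) (μ : P2 d) (x' p : E d) : E d →L[ℝ] E d :=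
  wDeriv (fun ν => dx H x ν p) μ x'

/-- `∂_{pμ} H (x, μ, x̃, p)`. -/
def dpμ (H : E d → P2 d → E d → ℝ) (x : E d) (μ : P2 d) (x' p : E d) : E d →L[ℝ] E d :=
  wDeriv (fun ν => dp H x ν p) μ x'

/-- Fully `C²` Hamiltonians: `H` and its first derivatives `∂_x H`, `∂_p H` (functions of
`(x, p)` and `μ`) and `∂_μ H` (a function of `(x, p, x̃)` and `μ`) are fully `C¹`. -/
structure FullyC2 (H : E d → P2 d → E d → ℝ) : Prop where
  c1 : FullyC1 (fun (z : E d × E d) μ => H z.1 μ z.2)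
  c1_dx : FullyC1 (fun (z : E d × E d) μ => dx H z.1 μ z.2)
  c1_dp : FullyC1 (fun (z : E d × E d) μ => dp H z.1 μ z.2)
  c1_dμ : FullyC1 (fun (z : E d × E d × E d) μ => wDeriv (fun ν => H z.1 ν z.2.1) μ z.2.2)

/-- The symmetric part of a square matrix. -/
def symPart (A : E d →L[ℝ] E d) : E d →L[ℝ] E d :=
  (1 / 2 : ℝ) • (A + ContinuousLinearMap.adjoint A)

/-- The smallest eigenvalue of a symmetric matrix. -/
def lambdaMin (A : E d →L[ℝ] E d) : ℝ :=
  sInf {r : ℝ | Module.End.HasEigenvalue (A : E d →ₗ[ℝ] E d) r}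

/-- The values of the smallest eigenvalue of the symmetric part of `A`, for a matrix field `A`
on the `(x, μ, p)`-space. -/
def lowerValues (A : E d → P2 d → E d → E d →L[ℝ] E d) : Set ℝ :=
  range fun z : E d × P2 d × E d => lambdaMin (symPart (A z.1 z.2.1 z.2.2))

/-- The values of the `2`-norm of a matrix field on the `(x, μ, p)`-space. -/
def normValues (A : E d → P2 d → E d → E d →L[ℝ] E d) : Set ℝ :=
  range fun z : E d × P2 d × E d => ‖A z.1 z.2.1 z.2.2‖

/-- The values of the `2`-norm of a matrix field on the `(x, μ, x̃, p)`-space. -/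
def normValues' (A : E d → P2 d → E d → E d → E d →L[ℝ] E d) : Set ℝ :=
  range fun z : E d × P2 d × E d × E d => ‖A z.1 z.2.1 z.2.2.1 z.2.2.2‖

/-- The lower bound of the symmetric part of `∂_{xp} H`. -/
def kappa (H : E d → P2 d → E d → ℝ) : ℝ := sInf (lowerValues (dxp H))

/-- `|∂_{xx} H|`. -/
def supXX (H : E d → P2 d → E d → ℝ) : ℝ := sSup (normValues (dxx H))

/-- `|∂_{pp} H|`. -/
def supPP (H : E d → P2 d → E d → ℝ) : ℝ := sSup (normValues (dpp H))

/-- `|∂_{xμ} H|`. -/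
def supXμ (H : E d → P2 d → E d → ℝ) : ℝ := sSup (normValues' (dxμ H))

/-- `|∂_{pμ} H|`. -/
def supPμ (H : E d → P2 d → E d → ℝ) : ℝ := sSup (normValues' (dpμ H))

/-- The constant `L_our`. -/
def Lour (c₀ : ℝ) (H : E d → P2 d → E d → ℝ) : ℝ :=
  supXμ H + 1 / 4 * c₀ * supPμ H ^ 2 + supXX H

/-- The left end `α₋` of the interval. -/
def alphaMinus (c₀ : ℝ) (H : E d → P2 d → E d → ℝ) : ℝ :=
  (kappa H - 1 / 2 * supPμ H
    - Real.sqrt ((kappa H - 1 / 2 * supPμ H) ^ 2 - supPP H * Lour c₀ H)) / supPP H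

/-- The right end `α₊` of the interval. -/
def alphaPlus (c₀ : ℝ) (H : E d → P2 d → E d → ℝ) : ℝ :=
  (kappa H - 1 / 2 * supPμ H
    + Real.sqrt ((kappa H - 1 / 2 * supPμ H) ^ 2 - supPP H * Lour c₀ H)) / supPP H

/-- The transformed Hamiltonian `H_α (x, μ, p) = H (x, μ, p - α x)`. -/
def transform (α : ℝ) (H : E d → P2 d → E d → ℝ) : E d → P2 d → E d → ℝ :=
  fun x μ p => H x μ (p - α • x)

/-- The integral of `f` exists in `(-∞, +∞]` and is nonnegative: the negative part of `f` has
finite integral, which is at most that of the positive part. -/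
def IntegralNonneg {Ω : Type*} [MeasurableSpace Ω] (γ : Measure Ω) (f : Ω → ℝ) : Prop :=
  ∫⁻ z, ENNReal.ofReal (-f z) ∂γ ≠ ∞ ∧
    ∫⁻ z, ENNReal.ofReal (-f z) ∂γ ≤ ∫⁻ z, ENNReal.ofReal (f z) ∂γ

/-- For an integrable function the definition reduces to the usual inequality. -/
theorem integralNonneg_iff {Ω : Type*} [MeasurableSpace Ω] {γ : Measure Ω} {f : Ω → ℝ}
    (hf : Integrable f γ) : IntegralNonneg γ f ↔ 0 ≤ ∫ z, f z ∂γ := by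
  have hn : ∫⁻ z, ENNReal.ofReal (-f z) ∂γ ≠ ∞ := hf.neg.lintegral_lt_top.ne
  have hp : ∫⁻ z, ENNReal.ofReal (f z) ∂γ ≠ ∞ := hf.lintegral_lt_top.ne
  rw [integral_eq_lintegral_pos_part_sub_lintegral_neg_part hf, sub_nonneg,
    ENNReal.toReal_le_toReal hn hp]
  exact ⟨fun h => h.2, fun h => ⟨hn, h⟩⟩

/-- Displacement monotone Hamiltonians: for all `μ`, `ν`, all transport plans `γ` and all bounded
continuous `p¹`, `p²`,
`-∫ [∂_x H(x,μ,p¹(x)) - ∂_x H(y,ν,p²(y))]·(x - y) dγ`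
` + ∫ [∂_p H(x,μ,p¹(x)) - ∂_p H(y,ν,p²(y))]·(p¹(x) - p²(y)) dγ ≥ 0`,
the sum being read as one integral with values in `(-∞, +∞]`. -/
structure DisplacementMonotone (H : E d → P2 d → E d → ℝ) : Prop where
  contDiff : ∀ μ, ContDiff ℝ 1 (fun z : E d × E d => H z.1 μ z.2)
  nonneg : ∀ (μ ν : P2 d) (γ : Measure (E d × E d)), IsPlan γ μ ν →
    ∀ p₁ p₂ : E d →ᵇ E d,
      IntegralNonneg γ fun z =>
        -⟪dx H z.1 μ (p₁ z.1) - dx H z.2 ν (p₂ z.2), z.1 - z.2⟫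
          + ⟪dp H z.1 μ (p₁ z.1) - dp H z.2 ν (p₂ z.2), p₁ z.1 - p₂ z.2⟫

end Hamiltonian

end MFG

end

/-! Put `u = x - y` and `q = p - α x`. The integrand for `H_α` becomes `-Δ∂_xH·u + 2α Δ∂_pH·u +
Δ∂_pH·w`, where `w = q¹ - q²` and `Δ` is the difference between the states `(x, q¹, μ)` and `(y, q²,
ν)`. It is bounded below through its derivative along a path joining these states: a segment in the
vectors, the displacement interpolation of `γ` itself in the measure
(`FullyC1.hasDerivAt_line_displacement`). An arbitrary `γ` will do, because the Wasserstein
derivative is tested against all plans, not only optimal ones.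

In that derivative (`quadratic_lower_bound`) the terms `∂_{xp}H w·u` and `∂_{px}H u·w` cancel.
Completing the square in `w + α u` costs at most `α²|∂_{pp}H||u|²`, and strong convexity in `p` pays
for the part of the `∂_{pμ}H` term paired with `w + α u`, up to `c₀/4 |∂_{pμ}H|² m²`, where `m = ∫
|x - y| dγ`. Integrating over `γ` with `m² ≤ ∫ |x - y|² dγ` leaves at least `2α(κ - |∂_{pμ}H|/2) -
|∂_{pp}H|α² - L_our` times the quadratic cost. This factor is nonnegative between its roots `α₋` and
`α₊`. -/

noncomputable section

namespace MFG

open Filter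

/-! ### Transport plans and displacement interpolation -/

section Plans

variable {d : ℕ} {μ ν : P2 d} {γ : Measure (E d × E d)}

attribute [instance] P2.isProbabilityMeasure

theorem P2.ext_toMeasure {μ ν : P2 d} (h : μ.toMeasure = ν.toMeasure) : μ = ν := by
  cases μ; cases ν; cases h; rfl

theorem IsPlan.isProbabilityMeasure (h : IsPlan γ μ ν) : IsProbabilityMeasure γ := by
  constructor
  have h1 : γ.map Prod.fst univ = 1 := by rw [h.map_fst]; exact measure_univ
  rwa [Measure.map_apply measurable_fst MeasurableSet.univ, preimage_univ] at h1

theorem IsPlan.integrable_fst (h : IsPlan γ μ ν) : Integrable (fun z => ‖z.1‖ ^ 2) γ := by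
  have h1 := μ.secondMoment
  rw [← h.map_fst] at h1
  exact h1.comp_measurable measurable_fst

theorem IsPlan.integrable_snd (h : IsPlan γ μ ν) : Integrable (fun z => ‖z.2‖ ^ 2) γ := by
  have h1 := ν.secondMoment
  rw [← h.map_snd] at h1
  exact h1.comp_measurable measurable_snd

theorem IsPlan.memLp_fst (h : IsPlan γ μ ν) : MemLp (fun z : E d × E d => z.1) 2 γ :=
  (memLp_two_iff_integrable_sq_norm measurable_fst.aestronglyMeasurable).2 h.integrable_fst

theorem IsPlan.memLp_snd (h : IsPlan γ μ ν) : MemLp (fun z : E d × E d => z.2) 2 γ :=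
  (memLp_two_iff_integrable_sq_norm measurable_snd.aestronglyMeasurable).2 h.integrable_snd

theorem IsPlan.memLp_sub (h : IsPlan γ μ ν) : MemLp (fun z : E d × E d => z.1 - z.2) 2 γ :=
  h.memLp_fst.sub h.memLp_snd

theorem IsPlan.integrable_sq_norm_sub (h : IsPlan γ μ ν) :
    Integrable (fun z => ‖z.1 - z.2‖ ^ 2) γ :=
  (memLp_two_iff_integrable_sq_norm h.memLp_sub.1).1 h.memLp_sub

theorem IsPlan.integrable_sub (h : IsPlan γ μ ν) : Integrable (fun z => z.1 - z.2) γ :=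
  have := h.isProbabilityMeasure
  h.memLp_sub.integrable one_le_two

/-- Jensen's inequality, from integrating the tangent-line bound `2 m r - m² ≤ r²` at the mean `m`.
-/
theorem IsPlan.sq_integral_norm_sub_le (h : IsPlan γ μ ν) :
    (∫ z, ‖z.1 - z.2‖ ∂γ) ^ 2 ≤ quadCost γ := by
  have := h.isProbabilityMeasure
  set m := ∫ z, ‖z.1 - z.2‖ ∂γ with hm
  have h1 : ∫ z, (2 * m * ‖z.1 - z.2‖ - m ^ 2) ∂γ ≤ quadCost γ := by
    refine integral_mono ((h.integrable_sub.norm.const_mul _).sub (integrable_const _))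
      h.integrable_sq_norm_sub fun z => ?_
    nlinarith [sq_nonneg (‖z.1 - z.2‖ - m)]
  rw [integral_sub (h.integrable_sub.norm.const_mul _) (integrable_const _),
    integral_const_mul, ← hm] at h1
  simp only [integral_const, probReal_univ, one_smul] at h1
  linarith

theorem W2_le (h : IsPlan γ μ ν) : W2 μ ν ≤ Real.sqrt (quadCost γ) := by
  refine Real.sqrt_le_sqrt (ciInf_le (f := fun γ : {γ // IsPlan γ μ ν} => quadCost γ.1) ?_ ⟨γ, h⟩)
  refine ⟨0, ?_⟩
  rintro _ ⟨γ', rfl⟩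
  exact integral_nonneg fun z => sq_nonneg _

/-- The point `(1 - t) z₂ + t z₁` on the line through the two components of `z`. -/
def lineMap (t : ℝ) (z : E d × E d) : E d := z.2 + t • (z.1 - z.2)

theorem continuous_lineMap (t : ℝ) : Continuous (lineMap (d := d) t) := by
  unfold lineMap; fun_prop

/-- The displacement interpolation along a transport plan. -/
def displacement (h : IsPlan γ μ ν) (t : ℝ) : P2 d where
  toMeasure := γ.map (lineMap t)
  isProbabilityMeasure := by
    have := h.isProbabilityMeasure
    exact Measure.isProbabilityMeasure_map (continuous_lineMap t).aemeasurable
  secondMoment := by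
    refine (integrable_map_measure (by fun_prop) (continuous_lineMap t).aemeasurable).2 ?_
    exact (memLp_two_iff_integrable_sq_norm (continuous_lineMap t).aestronglyMeasurable).1
      (h.memLp_snd.add (h.memLp_sub.const_smul t))

theorem displacement_zero (h : IsPlan γ μ ν) : displacement h 0 = ν := by
  refine P2.ext_toMeasure ?_
  have : lineMap (d := d) 0 = Prod.snd := by ext z; simp [lineMap]
  simp only [displacement, this, h.map_snd]

theorem displacement_one (h : IsPlan γ μ ν) : displacement h 1 = μ := by
  refine P2.ext_toMeasure ?_
  have : lineMap (d := d) 1 = Prod.fst := by ext z; simp [lineMap]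
  simp only [displacement, this, h.map_fst]

/-- Both interpolants are images of the same `γ`, and each `z` moves at constant velocity `z.1 -
z.2`. The root cost of this plan is therefore `|s - t|` times that of `γ`, whether or not `γ` is
optimal. -/
theorem isPlan_displacement (h : IsPlan γ μ ν) (t s : ℝ) :
    IsPlan (γ.map fun z => (lineMap t z, lineMap s z)) (displacement h t) (displacement h s) where
  map_fst := by
    rw [Measure.map_map measurable_fst
      ((continuous_lineMap t).prodMk (continuous_lineMap s)).measurable]
    rfl
  map_snd := by
    rw [Measure.map_map measurable_snd
      ((continuous_lineMap t).prodMk (continuous_lineMap s)).measurable]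
    rfl

theorem lineMap_sub_lineMap (t s : ℝ) (z : E d × E d) :
    lineMap s z - lineMap t z = (s - t) • (z.1 - z.2) := by
  simp only [lineMap, sub_smul]; abel

theorem sqrt_quadCost_displacement (γ : Measure (E d × E d)) (t s : ℝ) :
    Real.sqrt (quadCost (γ.map fun z => (lineMap t z, lineMap s z)))
      = |s - t| * Real.sqrt (quadCost γ) := by
  have h1 : quadCost (γ.map fun z => (lineMap t z, lineMap s z)) = (s - t) ^ 2 * quadCost γ := by
    unfold quadCost
    rw [integral_map ((continuous_lineMap t).prodMk (continuous_lineMap s)).aemeasurable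
      (by fun_prop), ← integral_const_mul]
    refine integral_congr_ae (.of_forall fun z => ?_)
    simp only
    rw [norm_sub_rev, lineMap_sub_lineMap, norm_smul, mul_pow, Real.norm_eq_abs, sq_abs]
  rw [h1, Real.sqrt_mul (sq_nonneg _), Real.sqrt_sq_eq_abs]

theorem tendsto_sqrt_quadCost_displacement (γ : Measure (E d × E d)) (t : ℝ) :
    Tendsto (fun s => Real.sqrt (quadCost (γ.map fun z => (lineMap t z, lineMap s z))))
      (𝓝 t) (𝓝 0) := by
  simp only [sqrt_quadCost_displacement]
  have : Continuous fun s : ℝ => |s - t| * Real.sqrt (quadCost γ) := by fun_prop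
  simpa using this.tendsto t

theorem continuous_displacement (h : IsPlan γ μ ν) : Continuous (displacement h) := by
  refine ⟨fun U hU => isOpen_iff_mem_nhds.2 fun t ht => ?_⟩
  obtain ⟨ε, hε, H⟩ := hU _ ht
  filter_upwards [(tendsto_sqrt_quadCost_displacement γ t).eventually (gt_mem_nhds hε)] with s hs
  exact H _ ((W2_le (isPlan_displacement h t s)).trans_lt hs)

end Plans

/-! ### Chain rule along displacement interpolations -/

section ChainRule

variable {d : ℕ} {W : Type*} [NormedAddCommGroup W] [NormedSpace ℝ W]
  {X : Type*} [NormedAddCommGroup X] [NormedSpace ℝ X] {F : X → P2 d → W}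
  {μ ν : P2 d} {γ : Measure (E d × E d)}

theorem FullyC1.isWDeriv (hF : FullyC1 F) (x : X) : IsWDeriv (F x) (wDeriv (F x)) := by
  unfold wDeriv
  rw [dif_pos (hF.exists_wDeriv x)]
  exact (hF.exists_wDeriv x).choose_spec

theorem IsWDeriv.hasDerivAt_displacement {U : P2 d → W} {D : P2 d → E d → E d →L[ℝ] W}
    (hD : IsWDeriv U D) (h : IsPlan γ μ ν) (t : ℝ) :
    HasDerivAt (fun s => U (displacement h s))
      (∫ z, D (displacement h t) (lineMap t z) (z.1 - z.2) ∂γ) t := by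
  rw [hasDerivAt_iff_isLittleO, Asymptotics.isLittleO_iff]
  intro ε hε
  set c := Real.sqrt (quadCost γ)
  have hc : 0 ≤ c := Real.sqrt_nonneg _
  -- The denominator `c + 1` stays positive even when `γ` has zero cost.
  obtain ⟨δ, hδ, H⟩ := (hD.2 (displacement h t)).2 (ε / (c + 1)) (by positivity)
  filter_upwards [(tendsto_sqrt_quadCost_displacement γ t).eventually (gt_mem_nhds hδ)] with s hs
  have h1 := H _ _ (isPlan_displacement h t s) hs
  have hcont : Continuous (D (displacement h t)) :=
    hD.1.comp (continuous_const.prodMk continuous_id)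
  rw [integral_map ((continuous_lineMap t).prodMk (continuous_lineMap s)).aemeasurable
    (Continuous.aestronglyMeasurable (by fun_prop))] at h1
  simp only [lineMap_sub_lineMap, map_smul, integral_smul] at h1
  refine h1.trans ?_
  rw [sqrt_quadCost_displacement, Real.norm_eq_abs]
  change ε / (c + 1) * (|s - t| * c) ≤ _
  have : ε / (c + 1) * c ≤ ε := by
    rw [div_mul_eq_mul_div, div_le_iff₀ (by positivity)]
    nlinarith
  nlinarith [abs_nonneg (s - t)]

/-- The chain rule along a line in the vector variable and a displacement interpolation in the
measure variable. -/
theorem FullyC1.hasDerivAt_line_displacement (hF : FullyC1 F) (h : IsPlan γ μ ν) (a b : X)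
    (t : ℝ) :
    HasDerivAt (fun s => F (a + s • b) (displacement h s))
      (fderiv ℝ (fun x => F x (displacement h t)) (a + t • b) b
        + ∫ z, wDeriv (F (a + t • b)) (displacement h t) (lineMap t z) (z.1 - z.2) ∂γ) t := by
  have h2 := (hF.isWDeriv (a + t • b)).hasDerivAt_displacement h t
  rw [hasDerivAt_iff_isLittleO] at h2 ⊢
  have hline : Continuous fun s : ℝ => a + s • b := by fun_prop
  -- The increment is split at `F (a + t • b) (displacement h s)`. The vector increment is thus
  -- taken at the moving measure, and `h2` covers the measure increment at a fixed vector.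
  have h3 : (fun s : ℝ => F (a + s • b) (displacement h s) - F (a + t • b) (displacement h s)
      - (s - t) • fderiv ℝ (fun x => F x (displacement h t)) (a + t • b) b)
      =o[𝓝 t] fun s : ℝ => s - t := by
    rw [Asymptotics.isLittleO_iff]
    intro ε hε
    have hc : Continuous fun p : ℝ × X => fderiv ℝ (fun y => F y (displacement h p.1)) p.2 :=
      hF.continuous_fderiv.comp
        (continuous_snd.prodMk ((continuous_displacement h).comp continuous_fst))
    -- Joint continuity keeps the vector derivative close to its value at `t` for all nearby
    -- measures and points at once, so the mean value inequality holds uniformly in `s`.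
    have hnear := (hc.tendsto (t, a + t • b)).eventually
      (Metric.closedBall_mem_nhds _ (ε := ε / (‖b‖ + 1)) (by positivity))
    rw [nhds_prod_eq] at hnear
    obtain ⟨P, hP, Q, hQ, hPQ⟩ := eventually_prod_iff.1 hnear
    obtain ⟨r, hr, hrQ⟩ := Metric.eventually_nhds_iff_ball.1 hQ
    filter_upwards [hP, (hline.tendsto t).eventually (Metric.ball_mem_nhds _ hr)] with s hs hsr
    have h4 := (convex_ball (a + t • b) r).norm_image_sub_le_of_norm_fderiv_le' (𝕜 := ℝ)
      (φ := fderiv ℝ (fun x => F x (displacement h t)) (a + t • b))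
      (fun x _ => hF.differentiable (displacement h s) x)
      (fun x hx => mem_closedBall_iff_norm.1 (hPQ hs (hrQ x hx)))
      (Metric.mem_ball_self hr) hsr
    have hsub : a + s • b - (a + t • b) = (s - t) • b := by rw [sub_smul]; abel
    rw [hsub, map_smul, norm_smul (s - t) b] at h4
    refine h4.trans ?_
    have : ε / (‖b‖ + 1) * ‖b‖ ≤ ε := by
      rw [div_mul_eq_mul_div, div_le_iff₀ (by positivity)]
      nlinarith
    nlinarith [norm_nonneg (s - t)]
  refine (h3.add h2).congr_left fun s => ?_
  simp only [smul_add]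
  abel

end ChainRule

/-! ### Smallest eigenvalue and Rayleigh quotient -/

section SmallestEigenvalue

variable {d : ℕ}

theorem inner_symPart (A : E d →L[ℝ] E d) (v : E d) : ⟪symPart A v, v⟫ = ⟪A v, v⟫ := by
  simp only [symPart, smul_apply, add_apply,
    inner_smul_left, inner_add_left, ContinuousLinearMap.adjoint_inner_left]
  rw [real_inner_comm (A v) v]
  simp
  ring

theorem isSymmetric_symPart (A : E d →L[ℝ] E d) :
    (symPart A : E d →ₗ[ℝ] E d).IsSymmetric := by
  intro v w
  simp only [symPart, ContinuousLinearMap.coe_coe, smul_apply,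
    add_apply, inner_smul_left, inner_add_left, inner_smul_right,
    inner_add_right, ContinuousLinearMap.adjoint_inner_left,
    ContinuousLinearMap.adjoint_inner_right]
  simp [add_comm]

/-- The infimum of the Rayleigh quotient is itself an eigenvalue. The bound by `-‖A‖` makes both
infima genuine, not default values. -/
theorem lambdaMin_mul_sq_norm_le (A : E d →L[ℝ] E d) (hA : (A : E d →ₗ[ℝ] E d).IsSymmetric)
    (v : E d) : lambdaMin A * ‖v‖ ^ 2 ≤ ⟪A v, v⟫ := by
  by_cases hv : v = 0
  · simp [hv]
  have : Nontrivial (E d) := ⟨v, 0, hv⟩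
  have hvn : 0 < ‖v‖ ^ 2 := by positivity
  have hlow : ∀ x : E d, -‖A‖ * ‖x‖ ^ 2 ≤ ⟪A x, x⟫ := fun x => by
    have h1 := abs_real_inner_le_norm (A x) x
    have h2 := A.le_opNorm x
    have h3 := neg_abs_le ⟪A x, x⟫
    nlinarith [norm_nonneg x]
  have h1 : lambdaMin A ≤ ⨅ x : {x : E d // x ≠ 0}, ⟪A x, (x : E d)⟫ / ‖(x : E d)‖ ^ 2 := by
    refine csInf_le ⟨-‖A‖, fun r hr => ?_⟩ ?_
    · obtain ⟨x, hx⟩ := Module.End.HasEigenvalue.exists_hasEigenvector hr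
      have hx1 : A x = r • x := hx.apply_eq_smul
      have hx2 : 0 < ‖x‖ ^ 2 := by have := norm_pos_iff.2 hx.2; positivity
      have h2 := hlow x
      rw [hx1, real_inner_smul_left, real_inner_self_eq_norm_sq] at h2
      exact le_of_mul_le_mul_right h2 hx2
    · exact hA.hasEigenvalue_iInf_of_finiteDimensional
  have h2 : ⨅ x : {x : E d // x ≠ 0}, ⟪A x, (x : E d)⟫ / ‖(x : E d)‖ ^ 2
      ≤ ⟪A v, v⟫ / ‖v‖ ^ 2 := by
    refine ciInf_le (f := fun x : {x : E d // x ≠ 0} => ⟪A x, (x : E d)⟫ / ‖(x : E d)‖ ^ 2)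
      ⟨-‖A‖, ?_⟩ ⟨v, hv⟩
    rintro _ ⟨x, rfl⟩
    have hx : 0 < ‖(x : E d)‖ ^ 2 := by have := norm_pos_iff.2 x.2; positivity
    exact (le_div_iff₀ hx).2 (hlow x)
  exact (le_div_iff₀ hvn).1 (h1.trans h2)

end SmallestEigenvalue

/-! ### Second derivatives of `H` and the quadratic form -/

section Monotonicity

variable {d : ℕ} {H : E d → P2 d → E d → ℝ} {μ ν : P2 d} {γ : Measure (E d × E d)}

theorem FullyC1.contDiff {X W : Type*} [NormedAddCommGroup X] [NormedSpace ℝ X]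
    [NormedAddCommGroup W] [NormedSpace ℝ W] {F : X → P2 d → W} (hF : FullyC1 F) (μ : P2 d) :
    ContDiff ℝ 1 fun x => F x μ :=
  contDiff_one_iff_fderiv.2
    ⟨hF.differentiable μ, hF.continuous_fderiv.comp (continuous_id.prodMk continuous_const)⟩

/-- The derivative of a function on the `(x, p)`-space in terms of its partial derivatives. -/
theorem fderiv_apply_eq_partial {W : Type*} [NormedAddCommGroup W] [NormedSpace ℝ W]
    {f : E d × E d → W} (hf : Differentiable ℝ f) (x p u w : E d) :
    fderiv ℝ f (x, p) (u, w)
      = fderiv ℝ (fun y => f (y, p)) x u + fderiv ℝ (fun q => f (x, q)) p w := by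
  have h1 := HasFDerivAt.comp (g := f) (f := fun y => (y, p)) x (hf (x, p)).hasFDerivAt
    (hasFDerivAt_prodMk_left x p)
  have h2 := HasFDerivAt.comp (g := f) (f := fun q => (x, q)) p (hf (x, p)).hasFDerivAt
    (hasFDerivAt_prodMk_right x p)
  have h1' : fderiv ℝ (fun y => f (y, p)) x = _ := h1.fderiv
  have h2' : fderiv ℝ (fun q => f (x, q)) p = _ := h2.fderiv
  rw [h1', h2']
  simp [← map_add]

theorem inner_gradient_eq_fderiv {f : E d → ℝ} (x v : E d) :
    ⟪gradient f x, v⟫ = fderiv ℝ f x v := by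
  rw [gradient, InnerProductSpace.toDual_symm_apply]

theorem fderiv_hamiltonian_apply (hH : FullyC2 H) (μ : P2 d) (z b : E d × E d) :
    fderiv ℝ (fun z : E d × E d => H z.1 μ z.2) z b
      = ⟪dx H z.1 μ z.2, b.1⟫ + ⟪dp H z.1 μ z.2, b.2⟫ := by
  have h1 := fderiv_apply_eq_partial (hH.c1.differentiable μ) z.1 z.2 b.1 b.2
  simp only [dx, dp, inner_gradient_eq_fderiv]
  exact h1

theorem fderiv_dx_apply (hH : FullyC2 H) (μ : P2 d) (z b : E d × E d) :
    fderiv ℝ (fun z : E d × E d => dx H z.1 μ z.2) z b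
      = dxx H z.1 μ z.2 b.1 + dxp H z.1 μ z.2 b.2 :=
  fderiv_apply_eq_partial (hH.c1_dx.differentiable μ) z.1 z.2 b.1 b.2

theorem fderiv_dp_apply (hH : FullyC2 H) (μ : P2 d) (z b : E d × E d) :
    fderiv ℝ (fun z : E d × E d => dp H z.1 μ z.2) z b
      = fderiv ℝ (fun y => dp H y μ z.2) z.1 b.1 + dpp H z.1 μ z.2 b.2 :=
  fderiv_apply_eq_partial (hH.c1_dp.differentiable μ) z.1 z.2 b.1 b.2

/-- The symmetry of the second derivative of `H` in `(x, p)`. -/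
theorem second_fderiv_symmetric (hH : FullyC2 H) (μ : P2 d) (z a b : E d × E d) :
    ⟪fderiv ℝ (fun z : E d × E d => dx H z.1 μ z.2) z a, b.1⟫
        + ⟪fderiv ℝ (fun z : E d × E d => dp H z.1 μ z.2) z a, b.2⟫
      = ⟪fderiv ℝ (fun z : E d × E d => dx H z.1 μ z.2) z b, a.1⟫
        + ⟪fderiv ℝ (fun z : E d × E d => dp H z.1 μ z.2) z b, a.2⟫ := by
  -- The derivative of `H` in `(x, p)`, assembled from the partial gradients. These are
  -- differentiable, so the symmetry of second derivatives applies to `G`.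
  set G := fun z : E d × E d =>
    (innerSL ℝ (dx H z.1 μ z.2)).comp (ContinuousLinearMap.fst ℝ (E d) (E d))
      + (innerSL ℝ (dp H z.1 μ z.2)).comp (ContinuousLinearMap.snd ℝ (E d) (E d)) with hG
  have h1 : ∀ z, HasFDerivAt (fun z : E d × E d => H z.1 μ z.2) (G z) z := fun z => by
    have h2 := (hH.c1.differentiable μ z).hasFDerivAt
    have h3 : fderiv ℝ (fun z : E d × E d => H z.1 μ z.2) z = G z := by
      refine ContinuousLinearMap.ext fun b => ?_
      rw [fderiv_hamiltonian_apply hH]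
      simp [hG]
    rwa [h3] at h2
  have hx := hH.c1_dx.differentiable μ
  have hp := hH.c1_dp.differentiable μ
  have hdG : Differentiable ℝ G := by
    refine Differentiable.add ?_ ?_
    · exact (((innerSL ℝ).differentiable.comp hx).clm_comp (differentiable_const _))
    · exact (((innerSL ℝ).differentiable.comp hp).clm_comp (differentiable_const _))
  have hGz : ∀ z a b, fderiv ℝ G z a b
      = ⟪fderiv ℝ (fun z : E d × E d => dx H z.1 μ z.2) z a, b.1⟫
        + ⟪fderiv ℝ (fun z : E d × E d => dp H z.1 μ z.2) z a, b.2⟫ := fun z a b => by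
    have h2 : HasFDerivAt (fun z => G z b) _ z :=
      (hdG z).hasFDerivAt.clm_apply (hasFDerivAt_const b z)
    have h3 : HasFDerivAt (fun z => G z b) _ z :=
      ((hx z).hasFDerivAt.inner ℝ (hasFDerivAt_const b.1 z)).add
        ((hp z).hasFDerivAt.inner ℝ (hasFDerivAt_const b.2 z))
    have h4 := congrArg (fun L => L a) (h2.unique h3)
    simpa [fderivInnerCLM_apply] using h4
  rw [← hGz, ← hGz]
  exact second_derivative_symmetric h1 (hdG z).hasFDerivAt a b

/-- The mixed second derivatives `∂_{px} H` and `∂_{xp} H` are adjoint to each other. -/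
theorem inner_fderiv_dp_eq (hH : FullyC2 H) (μ : P2 d) (x p u w : E d) :
    ⟪fderiv ℝ (fun y => dp H y μ p) x u, w⟫ = ⟪dxp H x μ p w, u⟫ := by
  -- One direction purely in `x` and one purely in `p` isolate the mixed blocks.
  have h := second_fderiv_symmetric hH μ (x, p) (u, 0) (0, w)
  simp only [fderiv_dp_apply hH, fderiv_dx_apply hH] at h
  simpa using h

theorem inner_dpp_comm (hH : FullyC2 H) (μ : P2 d) (x p u w : E d) :
    ⟪dpp H x μ p u, w⟫ = ⟪dpp H x μ p w, u⟫ := by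
  have h := second_fderiv_symmetric hH μ (x, p) (0, u) (0, w)
  simp only [fderiv_dp_apply hH, fderiv_dx_apply hH] at h
  simpa using h

theorem norm_dxx_le (hxx : BddAbove (normValues (dxx H))) (x : E d) (μ : P2 d) (p : E d) :
    ‖dxx H x μ p‖ ≤ supXX H :=
  le_csSup hxx ⟨(x, μ, p), rfl⟩

theorem norm_dpp_le (hpp : BddAbove (normValues (dpp H))) (x : E d) (μ : P2 d) (p : E d) :
    ‖dpp H x μ p‖ ≤ supPP H :=
  le_csSup hpp ⟨(x, μ, p), rfl⟩

theorem norm_dxμ_le (hxμ : BddAbove (normValues' (dxμ H))) (x : E d) (μ : P2 d) (x' p : E d) :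
    ‖dxμ H x μ x' p‖ ≤ supXμ H :=
  le_csSup hxμ ⟨(x, μ, x', p), rfl⟩

theorem norm_dpμ_le (hpμ : BddAbove (normValues' (dpμ H))) (x : E d) (μ : P2 d) (x' p : E d) :
    ‖dpμ H x μ x' p‖ ≤ supPμ H :=
  le_csSup hpμ ⟨(x, μ, x', p), rfl⟩

theorem kappa_mul_sq_norm_le (hκ : BddBelow (lowerValues (dxp H))) (x : E d) (μ : P2 d)
    (p v : E d) : kappa H * ‖v‖ ^ 2 ≤ ⟪dxp H x μ p v, v⟫ := by
  have h1 : kappa H ≤ lambdaMin (symPart (dxp H x μ p)) := csInf_le hκ ⟨(x, μ, p), rfl⟩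
  have h2 := lambdaMin_mul_sq_norm_le _ (isSymmetric_symPart (dxp H x μ p)) v
  rw [inner_symPart] at h2
  nlinarith [sq_nonneg ‖v‖]

/-- Makes the division in `α₋` and `α₊` legitimate. A nonzero vector needs `0 < d`, and a point mass
supplies a measure at which to evaluate. -/
theorem supPP_pos (hd : 0 < d) {c₀ : ℝ} (hc₀ : 0 < c₀)
    (hconv : ∀ (x : E d) (μ : P2 d) (p v : E d), c₀⁻¹ * ‖v‖ ^ 2 ≤ ⟪dpp H x μ p v, v⟫)
    (hpp : BddAbove (normValues (dpp H))) : 0 < supPP H := by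
  have : Nonempty (Fin d) := ⟨⟨0, hd⟩⟩
  obtain ⟨v, hv⟩ := exists_ne (0 : E d)
  have hv' : 0 < ‖v‖ := norm_pos_iff.2 hv
  let μ : P2 d :=
    { toMeasure := Measure.dirac 0
      isProbabilityMeasure := inferInstance
      secondMoment := (integrable_dirac (by simp)) }
  have h1 := hconv 0 μ 0 v
  have h2 := real_inner_le_norm (dpp H 0 μ 0 v) v
  have h3 := (dpp H 0 μ 0).le_of_opNorm_le (norm_dpp_le hpp 0 μ 0) v
  have h4 : 0 < c₀⁻¹ * ‖v‖ ^ 2 := by positivity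
  by_contra hneg
  nlinarith [sq_nonneg ‖v‖]

theorem IsPlan.norm_integral_clm_le (h : IsPlan γ μ ν) {D : E d × E d → E d →L[ℝ] E d} {C : ℝ}
    (hD : ∀ z, ‖D z‖ ≤ C) :
    ‖∫ z, D z (z.1 - z.2) ∂γ‖ ≤ C * ∫ z, ‖z.1 - z.2‖ ∂γ := by
  rw [← integral_const_mul]
  exact norm_integral_le_of_norm_le (h.integrable_sub.norm.const_mul _)
    (.of_forall fun z => (D z).le_of_opNorm_le (hD z) _)

/-- A lower bound for a quadratic form with perturbations `I`, `J` whose size is linear in `m`. -/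
theorem quadratic_lower_bound {V : Type*} [NormedAddCommGroup V] [InnerProductSpace ℝ V]
    {A B C P : V →L[ℝ] V} {I J u w : V} {α κ c₀ m SA SP SI SJ : ℝ} (hα : 0 ≤ α) (hc₀ : 0 < c₀)
    (hSI : 0 ≤ SI) (hSJ : 0 ≤ SJ)
    (hA : ‖A‖ ≤ SA) (hP : ‖P‖ ≤ SP) (hB : κ * ‖u‖ ^ 2 ≤ ⟪B u, u⟫)
    (hC : ∀ v v', ⟪C v, v'⟫ = ⟪B v', v⟫) (hPs : ∀ v v', ⟪P v, v'⟫ = ⟪P v', v⟫)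
    (hPc : ∀ v, c₀⁻¹ * ‖v‖ ^ 2 ≤ ⟪P v, v⟫)
    (hI : ‖I‖ ≤ SI * m) (hJ : ‖J‖ ≤ SJ * m) :
    (2 * α * κ - SA - α ^ 2 * SP - (SI + α * SJ) / 2) * ‖u‖ ^ 2
        - ((SI + α * SJ) / 2 + 1 / 4 * c₀ * SJ ^ 2) * m ^ 2
      ≤ -⟪A u + B w + I, u⟫ + 2 * α * ⟪C u + P w + J, u⟫ + ⟪C u + P w + J, w⟫ := by
  have e1 : ⟪A u, u⟫ ≤ SA * ‖u‖ ^ 2 := by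
    have h1 := real_inner_le_norm (A u) u
    have h2 := A.le_of_opNorm_le hA u
    nlinarith [norm_nonneg u]
  have e2 : ⟪P u, u⟫ ≤ SP * ‖u‖ ^ 2 := by
    have h1 := real_inner_le_norm (P u) u
    have h2 := P.le_of_opNorm_le hP u
    nlinarith [norm_nonneg u]
  -- The two halves recombine after integration over `γ`, where `m ^ 2` is at most the integral of
  -- `‖u‖ ^ 2`.
  have e3 : ⟪I, u⟫ ≤ SI * (m ^ 2 + ‖u‖ ^ 2) / 2 := by
    have h1 := real_inner_le_norm I u
    have h2 := mul_le_mul_of_nonneg_right hI (norm_nonneg u)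
    nlinarith [mul_nonneg hSI (sq_nonneg (m - ‖u‖))]
  have e4 : -⟪J, u⟫ ≤ SJ * (m ^ 2 + ‖u‖ ^ 2) / 2 := by
    have h1 := neg_le_of_abs_le (abs_real_inner_le_norm J u)
    have h2 := mul_le_mul_of_nonneg_right hJ (norm_nonneg u)
    nlinarith [mul_nonneg hSJ (sq_nonneg (m - ‖u‖))]
  -- Young's inequality with the weight that uses up the whole convexity bound on `w + α • u`. This
  -- is the origin of `c₀ / 4`.
  have e5 : -⟪J, w + α • u⟫ ≤ c₀⁻¹ * ‖w + α • u‖ ^ 2 + 1 / 4 * c₀ * SJ ^ 2 * m ^ 2 := by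
    have h1 := neg_le_of_abs_le (abs_real_inner_le_norm J (w + α • u))
    have h2 := mul_le_mul_of_nonneg_right hJ (norm_nonneg (w + α • u))
    have h3 : c₀⁻¹ * ‖w + α • u‖ ^ 2 + 1 / 4 * c₀ * SJ ^ 2 * m ^ 2 - SJ * m * ‖w + α • u‖
        = c₀⁻¹ * (‖w + α • u‖ - c₀ * (SJ * m) / 2) ^ 2 := by
      field_simp
      ring
    have h4 : 0 ≤ c₀⁻¹ * (‖w + α • u‖ - c₀ * (SJ * m) / 2) ^ 2 := by positivity
    linarith
  have e6 := hPc (w + α • u)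
  have e7 := mul_le_mul_of_nonneg_left hB (by positivity : 0 ≤ 2 * α)
  have e8 := mul_le_mul_of_nonneg_left e2 (sq_nonneg α)
  have e9 := mul_le_mul_of_nonneg_left e4 hα
  rw [map_add, map_smul] at e6
  -- By `hC` the terms `⟪B w, u⟫` and `⟪C u, w⟫` cancel. The `P` terms are the form at `w + α • u`
  -- minus `α ^ 2 * ⟪P u, u⟫`, and the `J` terms split as `⟪J, w + α • u⟫ + α * ⟪J, u⟫`.
  simp only [inner_add_left, inner_add_right, real_inner_smul_left, real_inner_smul_right, hC]
    at e5 e6 ⊢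
  have e10 := hPs u w
  rw [e10] at e6
  linarith

end Monotonicity

/-! ### The transformed Hamiltonian -/

section Transform

variable {d : ℕ} {H : E d → P2 d → E d → ℝ} {μ ν : P2 d} {γ : Measure (E d × E d)}

theorem dp_transform (α : ℝ) (H : E d → P2 d → E d → ℝ) (x : E d) (μ : P2 d) (p : E d) :
    dp (transform α H) x μ p = dp H x μ (p - α • x) := by
  simp only [dp, transform, gradient]
  rw [fderiv_comp_sub (f := fun q => H x μ q)]

theorem dx_transform (hH : FullyC2 H) (α : ℝ) (x : E d) (μ : P2 d) (p : E d) :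
    dx (transform α H) x μ p = dx H x μ (p - α • x) - α • dp H x μ (p - α • x) := by
  refine ext_inner_right ℝ fun v => ?_
  have h1 : HasFDerivAt (fun y : E d => (y, p - α • y))
      ((ContinuousLinearMap.id ℝ (E d)).prod (-(α • ContinuousLinearMap.id ℝ (E d)))) x :=
    (hasFDerivAt_id x).prodMk (((hasFDerivAt_id x).const_smul α).const_sub p)
  have h2 := HasFDerivAt.comp (g := fun z : E d × E d => H z.1 μ z.2) x
    (hH.c1.differentiable μ (x, p - α • x)).hasFDerivAt h1
  have h3 : fderiv ℝ (fun y => transform α H y μ p) x = _ := h2.fderiv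
  rw [dx, inner_gradient_eq_fderiv, h3, ContinuousLinearMap.comp_apply,
    fderiv_hamiltonian_apply hH]
  rw [inner_sub_left, real_inner_smul_left]
  simp [real_inner_smul_right, sub_eq_add_neg]

theorem contDiff_transform (hH : FullyC2 H) (α : ℝ) (μ : P2 d) :
    ContDiff ℝ 1 fun z : E d × E d => transform α H z.1 μ z.2 := by
  have h1 : ContDiff ℝ 1 fun z : E d × E d => (z.1, z.2 - α • z.1) := by fun_prop
  exact (hH.c1.contDiff μ).comp h1

/-- The pointwise lower bound for the integrand of displacement monotonicity. -/
theorem lower_bound_integrand (hH : FullyC2 H) {c₀ : ℝ} (hc₀ : 0 < c₀)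
    (hconv : ∀ (x : E d) (μ : P2 d) (p v : E d), c₀⁻¹ * ‖v‖ ^ 2 ≤ ⟪dpp H x μ p v, v⟫)
    (hκ : BddBelow (lowerValues (dxp H))) (hpp : BddAbove (normValues (dpp H)))
    (hxx : BddAbove (normValues (dxx H))) (hpμ : BddAbove (normValues' (dpμ H)))
    (hxμ : BddAbove (normValues' (dxμ H))) {α : ℝ} (hα : 0 ≤ α) (h : IsPlan γ μ ν)
    (x y q₁ q₂ : E d) :
    (2 * α * kappa H - supXX H - α ^ 2 * supPP H - (supXμ H + α * supPμ H) / 2) * ‖x - y‖ ^ 2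
        - ((supXμ H + α * supPμ H) / 2 + 1 / 4 * c₀ * supPμ H ^ 2)
          * (∫ z, ‖z.1 - z.2‖ ∂γ) ^ 2
      ≤ -⟪dx H x μ q₁ - dx H y ν q₂, x - y⟫ + 2 * α * ⟪dp H x μ q₁ - dp H y ν q₂, x - y⟫
        + ⟪dp H x μ q₁ - dp H y ν q₂, q₁ - q₂⟫ := by
  -- The path starts at `(y, q₂, ν)` for `s = 0` and ends at `(x, q₁, μ)` for `s = 1`.
  set a : E d × E d := (y, q₂)
  set b : E d × E d := (x - y, q₁ - q₂)
  set φ : ℝ → ℝ := fun s =>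
    -⟪dx H (a + s • b).1 (displacement h s) (a + s • b).2, x - y⟫
      + 2 * α * ⟪dp H (a + s • b).1 (displacement h s) (a + s • b).2, x - y⟫
      + ⟪dp H (a + s • b).1 (displacement h s) (a + s • b).2, q₁ - q₂⟫ with hφ
  have key : ∀ t, ∃ φ', HasDerivAt φ φ' t ∧
      (2 * α * kappa H - supXX H - α ^ 2 * supPP H - (supXμ H + α * supPμ H) / 2) * ‖x - y‖ ^ 2
        - ((supXμ H + α * supPμ H) / 2 + 1 / 4 * c₀ * supPμ H ^ 2)
          * (∫ z, ‖z.1 - z.2‖ ∂γ) ^ 2 ≤ φ' := fun t => by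
    have h1 := hH.c1_dx.hasDerivAt_line_displacement h a b t
    have h2 := hH.c1_dp.hasDerivAt_line_displacement h a b t
    rw [fderiv_dx_apply hH] at h1
    rw [fderiv_dp_apply hH] at h2
    have hu := fun L : E d => hasDerivAt_const t L
    refine ⟨_, ?_, quadratic_lower_bound (A := dxx H (a + t • b).1 (displacement h t) (a + t • b).2)
      (B := dxp H (a + t • b).1 (displacement h t) (a + t • b).2)
      (C := fderiv ℝ (fun y => dp H y (displacement h t) (a + t • b).2) (a + t • b).1)
      (P := dpp H (a + t • b).1 (displacement h t) (a + t • b).2)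
      (I := ∫ z, dxμ H (a + t • b).1 (displacement h t) (lineMap t z) (a + t • b).2
        (z.1 - z.2) ∂γ)
      (J := ∫ z, dpμ H (a + t • b).1 (displacement h t) (lineMap t z) (a + t • b).2
        (z.1 - z.2) ∂γ)
      (u := x - y) (w := q₁ - q₂) hα hc₀
      ((norm_nonneg _).trans (norm_dxμ_le hxμ x μ x x))
      ((norm_nonneg _).trans (norm_dpμ_le hpμ x μ x x))
      (norm_dxx_le hxx _ _ _) (norm_dpp_le hpp _ _ _) (kappa_mul_sq_norm_le hκ _ _ _ _)
      (fun v v' => inner_fderiv_dp_eq hH _ _ _ _ _) (fun v v' => inner_dpp_comm hH _ _ _ _ _)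
      (hconv _ _ _) (h.norm_integral_clm_le fun z => norm_dxμ_le hxμ _ _ _ _)
      (h.norm_integral_clm_le fun z => norm_dpμ_le hpμ _ _ _ _)⟩
    have h3 := (((h1.inner ℝ (hu (x - y))).neg).add
      ((h2.inner ℝ (hu (x - y))).const_mul (2 * α))).add (h2.inner ℝ (hu (q₁ - q₂)))
    simp only [inner_zero_right, zero_add] at h3
    exact h3
  choose φ' hφ' hle using key
  -- The interpolation is defined for every real `t`, so the derivative bound holds on the whole
  -- line and the mean value inequality gives `φ 1 - φ 0`.
  have h1 := mul_sub_le_image_sub_of_le_deriv (fun t => (hφ' t).differentiableAt)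
    (fun t => (hle t).trans_eq (hφ' t).deriv.symm) (zero_le_one (α := ℝ))
  simp only [hφ, a, b, displacement_zero, displacement_one, zero_smul, one_smul, add_zero,
    Prod.mk_add_mk, add_sub_cancel, sub_zero, mul_one] at h1
  simp only [inner_sub_left] at h1 ⊢
  linarith

/-- `f` need not be integrable: the integrable minorant controls its negative part, and its positive
part may have infinite integral. -/
theorem integralNonneg_of_le {Ω : Type*} [MeasurableSpace Ω] {γ : Measure Ω} {f b : Ω → ℝ}
    (hb : Integrable b γ) (hb0 : 0 ≤ ∫ z, b z ∂γ) (hbf : ∀ z, b z ≤ f z) :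
    IntegralNonneg γ f := by
  obtain ⟨h1, h2⟩ := (integralNonneg_iff hb).2 hb0
  have h3 : ∫⁻ z, ENNReal.ofReal (-f z) ∂γ ≤ ∫⁻ z, ENNReal.ofReal (-b z) ∂γ :=
    lintegral_mono fun z => ENNReal.ofReal_le_ofReal (neg_le_neg (hbf z))
  exact ⟨ne_top_of_le_ne_top h1 h3,
    (h3.trans h2).trans (lintegral_mono fun z => ENNReal.ofReal_le_ofReal (hbf z))⟩

/-- `H_α` is displacement monotone if `α` satisfies the quadratic inequality with roots `α₋`
and `α₊`. -/
theorem displacementMonotone_transform (hH : FullyC2 H) {c₀ : ℝ} (hc₀ : 0 < c₀)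
    (hconv : ∀ (x : E d) (μ : P2 d) (p v : E d), c₀⁻¹ * ‖v‖ ^ 2 ≤ ⟪dpp H x μ p v, v⟫)
    (hκ : BddBelow (lowerValues (dxp H))) (hpp : BddAbove (normValues (dpp H)))
    (hxx : BddAbove (normValues (dxx H))) (hpμ : BddAbove (normValues' (dpμ H)))
    (hxμ : BddAbove (normValues' (dxμ H))) {α : ℝ} (hα : 0 ≤ α)
    (hquad : supPP H * α ^ 2 + Lour c₀ H ≤ 2 * α * (kappa H - 1 / 2 * supPμ H)) :
    DisplacementMonotone (transform α H) where
  contDiff := contDiff_transform hH α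
  nonneg μ ν γ h p₁ p₂ := by
    have := h.isProbabilityMeasure
    have hSX : 0 ≤ supXμ H := (norm_nonneg _).trans (norm_dxμ_le hxμ 0 μ 0 0)
    have hSP : 0 ≤ supPμ H := (norm_nonneg _).trans (norm_dpμ_le hpμ 0 μ 0 0)
    refine integralNonneg_of_le
      (((h.integrable_sq_norm_sub).const_mul (2 * α * kappa H - supXX H - α ^ 2 * supPP H
        - (supXμ H + α * supPμ H) / 2)).sub (integrable_const
          (((supXμ H + α * supPμ H) / 2 + 1 / 4 * c₀ * supPμ H ^ 2)
            * (∫ z, ‖z.1 - z.2‖ ∂γ) ^ 2))) ?_ fun z => ?_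
    · simp only [Pi.sub_apply]
      rw [integral_sub (h.integrable_sq_norm_sub.const_mul _) (integrable_const _),
        integral_const_mul]
      simp only [integral_const, probReal_univ, one_smul]
      change 0 ≤ _ * quadCost γ - _
      have hQ : 0 ≤ quadCost γ := integral_nonneg fun z => sq_nonneg _
      have h1 := mul_le_mul_of_nonneg_left h.sq_integral_norm_sub_le
        (by positivity : 0 ≤ (supXμ H + α * supPμ H) / 2 + 1 / 4 * c₀ * supPμ H ^ 2)
      have h2 := mul_le_mul_of_nonneg_right hquad hQ
      simp only [Lour] at h2
      linarith
    -- The bound is pointwise, so the shifted momenta `p - α x` may be unbounded.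
    · refine (lower_bound_integrand hH hc₀ hconv hκ hpp hxx hpμ hxμ hα h z.1 z.2
        (p₁ z.1 - α • z.1) (p₂ z.2 - α • z.2)).trans_eq ?_
      simp only [dx_transform hH, dp_transform]
      simp only [inner_sub_left, inner_sub_right, real_inner_smul_left, real_inner_smul_right]
      ring

end Transform

end MFG

end

/-! ### The interval of admissible `α` -/

theorem theorem3p4 (d : ℕ) (hd : 0 < d)
    (H : MFG.E d → MFG.P2 d → MFG.E d → ℝ) (hH : MFG.FullyC2 H)
    (c₀ : ℝ) (hc₀ : 0 < c₀)
    (hconv : ∀ (x : MFG.E d) (μ : MFG.P2 d) (p v : MFG.E d),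
      c₀⁻¹ * ‖v‖ ^ 2 ≤ ⟪MFG.dpp H x μ p v, v⟫)
    (hκ : BddBelow (MFG.lowerValues (MFG.dxp H)))
    (hpp : BddAbove (MFG.normValues (MFG.dpp H)))
    (hxx : BddAbove (MFG.normValues (MFG.dxx H)))
    (hpμ : BddAbove (MFG.normValues' (MFG.dpμ H)))
    (hxμ : BddAbove (MFG.normValues' (MFG.dxμ H)))
    (hbound : 1 / 2 * MFG.supPμ H + Real.sqrt (MFG.supPP H * MFG.Lour c₀ H) ≤ MFG.kappa H) :
    (∀ α ∈ Set.Icc (MFG.alphaMinus c₀ H) (MFG.alphaPlus c₀ H),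
      MFG.DisplacementMonotone (MFG.transform α H)) ∧
    MFG.DisplacementMonotone
      (MFG.transform ((MFG.kappa H - 1 / 2 * MFG.supPμ H) / MFG.supPP H) H) := by
  have hP := MFG.supPP_pos hd hc₀ hconv hpp
  have hL : 0 ≤ MFG.Lour c₀ H := by
    have hX : 0 ≤ MFG.supXX H :=
      Real.sSup_nonneg (by rintro _ ⟨z, rfl⟩; exact norm_nonneg _)
    have hM : 0 ≤ MFG.supXμ H :=
      Real.sSup_nonneg (by rintro _ ⟨z, rfl⟩; exact norm_nonneg _)
    unfold MFG.Lour
    positivity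
  set k := MFG.kappa H - 1 / 2 * MFG.supPμ H with hk
  have hk1 : Real.sqrt (MFG.supPP H * MFG.Lour c₀ H) ≤ k := by rw [hk]; linarith
  have hk0 : 0 ≤ k := (Real.sqrt_nonneg _).trans hk1
  have hdisc : 0 ≤ k ^ 2 - MFG.supPP H * MFG.Lour c₀ H :=
    sub_nonneg.2 ((Real.sqrt_le_left hk0).1 hk1)
  set r := Real.sqrt (k ^ 2 - MFG.supPP H * MFG.Lour c₀ H) with hr
  have hr0 : 0 ≤ r := Real.sqrt_nonneg _
  have hr2 : r ^ 2 = k ^ 2 - MFG.supPP H * MFG.Lour c₀ H := Real.sq_sqrt hdisc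
  have hrk : r ≤ k := abs_le_of_sq_le_sq' (by nlinarith) hk0 |>.2
  have main : ∀ α ∈ Set.Icc (MFG.alphaMinus c₀ H) (MFG.alphaPlus c₀ H),
      MFG.DisplacementMonotone (MFG.transform α H) := by
    rintro α ⟨h1, h2⟩
    rw [MFG.alphaMinus, ← hk, ← hr, div_le_iff₀ hP] at h1
    rw [MFG.alphaPlus, ← hk, ← hr, le_div_iff₀ hP] at h2
    -- The left endpoint is nonnegative because `r ≤ k`.
    have hα : 0 ≤ α := by
      by_contra hneg
      nlinarith
    refine MFG.displacementMonotone_transform hH hc₀ hconv hκ hpp hxx hpμ hxμ hα ?_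
    rw [← hk]
    -- Membership in the interval means `|α * supPP H - k| ≤ r`. Squaring and inserting `hr2` gives
    -- `supPP H` times the required quadratic inequality.
    have h3 : (α * MFG.supPP H - k) ^ 2 ≤ r ^ 2 := sq_le_sq' (by linarith) (by linarith)
    refine le_of_mul_le_mul_left ?_ hP
    nlinarith
  -- The last value of `α` is the midpoint of the interval.
  refine ⟨main, main _ ⟨?_, ?_⟩⟩
  · rw [MFG.alphaMinus, ← hk, ← hr]
    exact div_le_div_of_nonneg_right (by linarith) hP.le
  · rw [MFG.alphaPlus, ← hk, ← hr]
    exact div_le_div_of_nonneg_right (by linarith) hP.le
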